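/- A product state in $\mathbb{C}^{d_1}\otimes\mathbb{C}^{d_2}\otimes\mathbb{C}^{d_3}$ is a vector of the form $v_1\otimes v_2\otimes v_3$ with each $v_j\in\mathbb{C}^{d_j}$ a unit vector. An unextendible product basis (UPB) of $\mathbb{C}^{d_1}\otimes\mathbb{C}^{d_2}\otimes\mathbb{C}^{d_3}$ is a set $S$ of mutually orthogonal product states such that for every product state $z\notin S$ there is $v\in S$ with $\langle v, z\rangle\neq 0$. Let $f_m(d_1,d_2,d_3)$ be the minimum number of vectors in a UPB of $\mathbb{C}^{d_1}\otimes\mathbb{C}^{d_2}\otimes\mathbb{C}^{d_3}$, and let $f_N(d_1,d_2,d_3) = \sum_{j=1}^{3}(d_j-1)+1$. **Theorem.** For every positive integer $k$, $$f_m(2,2,4k+1) = f_N(2,2,4k+1)+1 = 4k+4.$$ -/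

import Mathlib

open scoped TensorProduct

/-- The tripartite space `ℂ^{d₁} ⊗ ℂ^{d₂} ⊗ ℂ^{d₃}`, with Mathlib's inner product on the tensor
product of (Euclidean) inner product spaces. -/
abbrev TriSpace (d₁ d₂ d₃ : ℕ) : Type :=
  (EuclideanSpace ℂ (Fin d₁) ⊗[ℂ] EuclideanSpace ℂ (Fin d₂)) ⊗[ℂ] EuclideanSpace ℂ (Fin d₃)

/-- A product state: an elementary tensor of three unit vectors. -/
def IsProductState {d₁ d₂ d₃ : ℕ} (z : TriSpace d₁ d₂ d₃) : Prop :=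
  ∃ (a : EuclideanSpace ℂ (Fin d₁)) (b : EuclideanSpace ℂ (Fin d₂))
    (c : EuclideanSpace ℂ (Fin d₃)),
    ‖a‖ = 1 ∧ ‖b‖ = 1 ∧ ‖c‖ = 1 ∧ z = (a ⊗ₜ[ℂ] b) ⊗ₜ[ℂ] c

/-- An unextendible product basis of `ℂ^{d₁} ⊗ ℂ^{d₂} ⊗ ℂ^{d₃}`: a set of mutually orthogonal
product states such that no product state outside the set is orthogonal to all its elements. -/
structure IsUPB {d₁ d₂ d₃ : ℕ} (S : Set (TriSpace d₁ d₂ d₃)) : Prop where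
  isProductState : ∀ v ∈ S, IsProductState v
  orthogonal : ∀ v ∈ S, ∀ w ∈ S, v ≠ w → inner ℂ v w = 0
  unextendible : ∀ z, IsProductState z → z ∉ S → ∃ v ∈ S, inner ℂ v z ≠ 0

/-- The set of all (finite) sizes of unextendible product bases in
`ℂ^{d₁} ⊗ ℂ^{d₂} ⊗ ℂ^{d₃}`. Infinite orthogonal sets of unit vectors do not exist there. -/
def upbSizes (d₁ d₂ d₃ : ℕ) : Set ℕ :=
  {n : ℕ | ∃ S : Set (TriSpace d₁ d₂ d₃), IsUPB S ∧ S.encard = (n : ℕ∞)}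

/-- The trivial lower bound `f_N(d₁, d₂, d₃) = (d₁ - 1) + (d₂ - 1) + (d₃ - 1) + 1`, for positive
dimensions. -/
def fN (d₁ d₂ d₃ : ℕ) : ℕ := (d₁ - 1) + (d₂ - 1) + (d₃ - 1) + 1

/-- `f_m(d₁, d₂, d₃) = m`: the minimum number of vectors in an unextendible product basis of
`ℂ^{d₁} ⊗ ℂ^{d₂} ⊗ ℂ^{d₃}` exists and equals `m`. -/
def IsMinUPBSize (d₁ d₂ d₃ m : ℕ) : Prop := IsLeast (upbSizes d₁ d₂ d₃) m

/-! Lower bound (`card_ge_of_unextendible`): if there are fewer than d + 3 vectors, d odd,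
unextendibility forces exactly d + 2. It then makes each vector orthogonal to at most 1, 1, d - 1
others in the three parties. These must add up to d + 1, so orthogonality in the first party is a
perfect matching on an odd number of vertices, which is absurd.

Upper bound (`mem_upbSizes_prism`): index 4m vectors, m = k + 1, by the vertices of the prism over a
cycle of length N = 2m. Split its edges into disjoint 4-cycles, made orthogonal by the first party,
and single edges, made orthogonal by the second. The third party handles all non-adjacent pairs in
dimension 2N - 3, through a positive semidefinite block-circulant Gram matrix with three-dimensional
kernel. A nonzero x annihilates at most two vertices and a nonzero y at most one. Any 2N - 3 of the
third-party vectors span (`eq_zero_of_inner_prismVec_of_support`), so no product vector is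
orthogonal to the whole family. -/

/-! ### Lower bound: counting and parity. -/

theorem exists_unit_orthogonal {ι : Type*} {d : ℕ} (P : Finset ι)
    (f : ι → EuclideanSpace ℂ (Fin d)) (h : P.card < d) :
    ∃ a, ‖a‖ = 1 ∧ ∀ v ∈ P, inner ℂ (f v) a = 0 := by
  classical
  set W := Submodule.span ℂ ((P.image f : Finset _) : Set (EuclideanSpace ℂ (Fin d)))
  have hW : Module.finrank ℂ W < d :=
    ((finrank_span_finset_le_card _).trans Finset.card_image_le).trans_lt h
  have hne : Wᗮ ≠ ⊥ := by
    intro h0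
    have := W.finrank_add_finrank_orthogonal
    rw [h0, finrank_bot, finrank_euclideanSpace_fin] at this
    omega
  obtain ⟨x, hx, hx0⟩ := Submodule.exists_mem_ne_zero_of_ne_bot hne
  refine ⟨((‖x‖⁻¹ : ℝ) : ℂ) • x, ?_, fun v hv => ?_⟩
  · simp [norm_smul, hx0]
  · rw [inner_smul_right, (Submodule.mem_orthogonal W x).1 hx (f v)
      (Submodule.subset_span (by simpa using ⟨v, hv, rfl⟩)), mul_zero]

/-- One factor can annihilate d₁ - 1 members of X, and the other the at most d₂ - 1 that remain. -/
theorem exists_union_orthogonal {ι : Type*} {d₁ d₂ : ℕ} (X : Finset ι)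
    (f : ι → EuclideanSpace ℂ (Fin d₁)) (g : ι → EuclideanSpace ℂ (Fin d₂))
    (h₁ : 0 < d₁) (h₂ : 0 < d₂) (h : X.card + 2 ≤ d₁ + d₂) :
    ∃ a b, ‖a‖ = 1 ∧ ‖b‖ = 1 ∧ ∀ v ∈ X, inner ℂ (f v) a = 0 ∨ inner ℂ (g v) b = 0 := by
  classical
  obtain ⟨P, hP, hc⟩ := Finset.exists_subset_card_eq (s := X) (n := min X.card (d₁ - 1))
    (min_le_left _ _)
  obtain ⟨a, ha, ha'⟩ := exists_unit_orthogonal P f (by omega)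
  obtain ⟨b, hb, hb'⟩ := exists_unit_orthogonal (X \ P) g (by
    rw [Finset.card_sdiff_of_subset hP]; omega)
  refine ⟨a, b, ha, hb, fun v hv => ?_⟩
  by_cases h : v ∈ P
  · exact .inl (ha' v h)
  · exact .inr (hb' v (by simp [hv, h]))

theorem card_ge_of_unextendible {ι : Type*} [Fintype ι] {d : ℕ} (hd : Odd d)
    (a b : ι → EuclideanSpace ℂ (Fin 2)) (c : ι → EuclideanSpace ℂ (Fin d))
    (ha : ∀ v, ‖a v‖ = 1) (hb : ∀ v, ‖b v‖ = 1) (hc : ∀ v, ‖c v‖ = 1)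
    (orth : ∀ v w, v ≠ w →
      inner ℂ (a v) (a w) = 0 ∨ inner ℂ (b v) (b w) = 0 ∨ inner ℂ (c v) (c w) = 0)
    (unext : ∀ x y z, ‖x‖ = 1 → ‖y‖ = 1 → ‖z‖ = 1 →
      ∃ v, inner ℂ (a v) x ≠ 0 ∧ inner ℂ (b v) y ≠ 0 ∧ inner ℂ (c v) z ≠ 0) :
    d + 3 ≤ Fintype.card ι := by
  classical
  by_contra! hlt
  have hd0 : 0 < d := hd.pos
  have compl_card : ∀ P : Finset ι, Pᶜ.card = Fintype.card ι - P.card := fun P =>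
    Finset.card_compl P
  -- Otherwise the complement of P has at most d = 2 + d - 2 elements, and the other two parties
  -- annihilate it.
  have keyA : ∀ (P : Finset ι) (x), ‖x‖ = 1 → (∀ v ∈ P, inner ℂ (a v) x = 0) →
      P.card + d + 1 ≤ Fintype.card ι := by
    intro P x hx hP
    by_contra! hcard
    obtain ⟨y, z, hy, hz, h⟩ := exists_union_orthogonal Pᶜ b c two_pos hd0
      (by rw [compl_card]; omega)
    obtain ⟨v, h1, h2, h3⟩ := unext x y z hx hy hz
    rcases h v (by simpa using fun hv => h1 (hP v hv)) with h | h <;> contradiction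
  have keyB : ∀ (P : Finset ι) (x), ‖x‖ = 1 → (∀ v ∈ P, inner ℂ (b v) x = 0) →
      P.card + d + 1 ≤ Fintype.card ι := by
    intro P x hx hP
    by_contra! hcard
    obtain ⟨y, z, hy, hz, h⟩ := exists_union_orthogonal Pᶜ a c two_pos hd0
      (by rw [compl_card]; omega)
    obtain ⟨v, h1, h2, h3⟩ := unext y x z hy hx hz
    rcases h v (by simpa using fun hv => h2 (hP v hv)) with h | h <;> contradiction
  have keyC : ∀ (P : Finset ι) (x), ‖x‖ = 1 → (∀ v ∈ P, inner ℂ (c v) x = 0) →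
      P.card + 3 ≤ Fintype.card ι := by
    intro P x hx hP
    by_contra! hcard
    obtain ⟨y, z, hy, hz, h⟩ := exists_union_orthogonal Pᶜ a b two_pos two_pos
      (by rw [compl_card]; omega)
    obtain ⟨v, h1, h2, h3⟩ := unext y z x hy hz hx
    rcases h v (by simpa using fun hv => h3 (hP v hv)) with h | h <;> contradiction
  have hcard : Fintype.card ι = d + 2 := by
    obtain ⟨x, hx, -⟩ := exists_unit_orthogonal (d := 2) (∅ : Finset ι) a (by simp)
    have h0 := keyA ∅ x hx (by simp)
    obtain ⟨v⟩ : Nonempty ι := Fintype.card_pos_iff.1 (by omega)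
    obtain ⟨x, hx, hx'⟩ := exists_unit_orthogonal (d := 2) ({v} : Finset ι) a (by simp)
    have := keyA {v} x hx hx'
    simp at this
    omega
  let G : SimpleGraph ι :=
    { Adj := fun v w => v ≠ w ∧ inner ℂ (a v) (a w) = 0
      symm := ⟨fun v w h => ⟨h.1.symm, inner_eq_zero_symm.1 h.2⟩⟩
      loopless := ⟨fun v h => h.1 rfl⟩ }
  -- The d + 1 other vectors are covered by sets of sizes at most 1, 1 and d - 1, so every bound is
  -- attained.
  have hdeg : ∀ v, G.degree v = 1 := by
    intro v
    have hA := keyA (G.neighborFinset v) (a v) (ha v) fun w hw =>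
      inner_eq_zero_symm.1 ((G.mem_neighborFinset v w).1 hw).2
    have hB := keyB (Finset.univ.filter fun w => inner ℂ (b w) (b v) = 0) (b v) (hb v) (by simp)
    have hC := keyC (Finset.univ.filter fun w => inner ℂ (c w) (c v) = 0) (c v) (hc v) (by simp)
    have hsub : (Finset.univ.erase v) ⊆ G.neighborFinset v ∪
        ((Finset.univ.filter fun w => inner ℂ (b w) (b v) = 0) ∪
          (Finset.univ.filter fun w => inner ℂ (c w) (c v) = 0)) := by
      intro w hw
      have hne : w ≠ v := (Finset.mem_erase.1 hw).1
      rcases orth w v hne with h | h | h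
      · simp only [Finset.mem_union, SimpleGraph.mem_neighborFinset]
        exact .inl ⟨hne.symm, inner_eq_zero_symm.1 h⟩
      · simp [h]
      · simp [h]
    have h1 := Finset.card_le_card hsub
    have h2 := Finset.card_union_le (G.neighborFinset v)
        ((Finset.univ.filter fun w => inner ℂ (b w) (b v) = 0) ∪
          (Finset.univ.filter fun w => inner ℂ (c w) (c v) = 0))
    have h3 := Finset.card_union_le (Finset.univ.filter fun w => inner ℂ (b w) (b v) = 0)
          (Finset.univ.filter fun w => inner ℂ (c w) (c v) = 0)
    rw [Finset.card_erase_of_mem (Finset.mem_univ _), Finset.card_univ] at h1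
    rw [SimpleGraph.card_neighborFinset_eq_degree] at *
    omega
  -- Handshake: d + 2 would be even.
  have hsum := G.sum_degrees_eq_twice_card_edges
  simp only [hdeg, Finset.sum_const, Finset.card_univ, smul_eq_mul, mul_one] at hsum
  obtain ⟨m, rfl⟩ := hd
  omega

theorem IsProductState.inner_self_ne_zero {d₁ d₂ d₃ : ℕ} {z : TriSpace d₁ d₂ d₃}
    (hz : IsProductState z) : inner ℂ z z ≠ 0 := by
  obtain ⟨a, b, c, ha, hb, hc, rfl⟩ := hz
  simp [TensorProduct.inner_tmul, inner_self_eq_norm_sq_to_K, ha, hb, hc]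

theorem IsUPB.encard_ge {d : ℕ} (hd : Odd d) {S : Set (TriSpace 2 2 d)} (hS : IsUPB S) {n : ℕ}
    (hn : S.encard = n) : d + 3 ≤ n := by
  have hfin : S.Finite := Set.finite_of_encard_eq_coe hn
  have := hfin.fintype
  choose a b c ha hb hc habc using fun v : S => hS.isProductState v v.2
  have hcard : Fintype.card S = n := by
    have := Set.encard_eq_coe_toFinset_card S
    rw [hn, Set.toFinset_card] at this
    exact_mod_cast this.symm
  rw [← hcard]
  refine card_ge_of_unextendible hd a b c ha hb hc (fun v w hvw => ?_) fun x y z hx hy hz => ?_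
  · have := hS.orthogonal v v.2 w w.2 (fun h => hvw (Subtype.ext h))
    rw [habc v, habc w] at this
    simpa [or_assoc] using this
  · have hp : IsProductState ((x ⊗ₜ[ℂ] y) ⊗ₜ[ℂ] z) := ⟨x, y, z, hx, hy, hz, rfl⟩
    -- Unextendibility only concerns states outside S; a member of S fails to be orthogonal to
    -- itself.
    by_cases hmem : ((x ⊗ₜ[ℂ] y) ⊗ₜ[ℂ] z) ∈ S
    · refine ⟨⟨_, hmem⟩, ?_⟩
      have h1 := hp.inner_self_ne_zero
      nth_rw 1 [show (x ⊗ₜ[ℂ] y) ⊗ₜ[ℂ] z = _ from habc ⟨_, hmem⟩] at h1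
      simpa [and_assoc, not_or] using h1
    · obtain ⟨v, hv, h⟩ := hS.unextendible _ hp hmem
      refine ⟨⟨v, hv⟩, ?_⟩
      rw [show v = _ from habc ⟨v, hv⟩] at h
      simpa [and_assoc, not_or] using h

/-! ### Upper bound: normalizing a family of product vectors. -/

/-- A family of product vectors that is pairwise orthogonal, and which no product vector is
orthogonal to, normalizes to an unextendible product basis. -/
theorem exists_isUPB_of_family {ι κ : Type*} [Fintype ι] [Fintype κ] {d₁ d₂ d₃ : ℕ}
    (hκ : Fintype.card κ = d₃)
    (a : ι → EuclideanSpace ℂ (Fin d₁)) (b : ι → EuclideanSpace ℂ (Fin d₂))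
    (c : ι → EuclideanSpace ℂ κ)
    (ha : ∀ v, a v ≠ 0) (hb : ∀ v, b v ≠ 0) (hc : ∀ v, c v ≠ 0)
    (orth : ∀ v w, v ≠ w →
      inner ℂ (a v) (a w) = 0 ∨ inner ℂ (b v) (b w) = 0 ∨ inner ℂ (c v) (c w) = 0)
    (unext : ∀ x y z, x ≠ 0 → y ≠ 0 → z ≠ 0 →
      ∃ v, inner ℂ (a v) x ≠ 0 ∧ inner ℂ (b v) y ≠ 0 ∧ inner ℂ (c v) z ≠ 0) :
    Fintype.card ι ∈ upbSizes d₁ d₂ d₃ := by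
  let e : EuclideanSpace ℂ κ ≃ₗᵢ[ℂ] EuclideanSpace ℂ (Fin d₃) :=
    LinearIsometryEquiv.piLpCongrLeft 2 ℂ ℂ (Fintype.equivFinOfCardEq hκ)
  let u : ι → TriSpace d₁ d₂ d₃ := fun v =>
    ((((‖a v‖⁻¹ : ℝ) : ℂ) • a v) ⊗ₜ[ℂ] (((‖b v‖⁻¹ : ℝ) : ℂ) • b v)) ⊗ₜ[ℂ]
      e (((‖c v‖⁻¹ : ℝ) : ℂ) • c v)
  have hu : ∀ v, IsProductState (u v) := fun v =>
    ⟨_, _, _, by simp [norm_smul, ha], by simp [norm_smul, hb],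
      by rw [LinearIsometryEquiv.norm_map]; simp [norm_smul, hc], rfl⟩
  have hinner : ∀ v x y z, inner ℂ (u v) ((x ⊗ₜ[ℂ] y) ⊗ₜ[ℂ] z) ≠ 0 ↔
      inner ℂ (a v) x ≠ 0 ∧ inner ℂ (b v) y ≠ 0 ∧ inner ℂ (c v) (e.symm z) ≠ 0 := by
    intro v x y z
    have : inner ℂ (e (c v)) z = inner ℂ (c v) (e.symm z) := by
      rw [← e.inner_map_map (c v), e.apply_symm_apply]
    simp only [u, TensorProduct.inner_tmul, map_smul, inner_smul_left, this]
    simp [ha, hb, hc, and_assoc]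
  have horth : ∀ v w, v ≠ w → inner ℂ (u v) (u w) = 0 := by
    intro v w hvw
    by_contra h
    obtain ⟨h1, h2, h3⟩ := (hinner v _ _ _).1 h
    simp only [map_smul, inner_smul_right, e.symm_apply_apply] at h1 h2 h3
    rcases orth v w hvw with h | h | h <;> simp_all
  have hinj : Function.Injective u := by
    intro v w hvw
    by_contra hne
    have h0 := horth v w hne
    rw [← hvw] at h0
    exact (hu v).inner_self_ne_zero h0
  refine ⟨Set.range u, ⟨?_, ?_, ?_⟩, ?_⟩
  · rintro _ ⟨v, rfl⟩
    exact hu v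
  · rintro _ ⟨v, rfl⟩ _ ⟨w, rfl⟩ h
    exact horth v w fun h' => h (h' ▸ rfl)
  · rintro _ ⟨x, y, z, hx, hy, hz, rfl⟩ -
    have hx0 : x ≠ 0 := by rintro rfl; simp at hx
    have hy0 : y ≠ 0 := by rintro rfl; simp at hy
    have hz0 : e.symm z ≠ 0 := by
      rw [Ne, LinearIsometryEquiv.map_eq_zero_iff]; rintro rfl; simp at hz
    obtain ⟨v, hv⟩ := unext x y _ hx0 hy0 hz0
    exact ⟨u v, ⟨v, rfl⟩, (hinner v x y z).2 hv⟩
  · rw [← Set.image_univ, hinj.encard_image, Set.encard_univ, ENat.card_eq_coe_fintype_card]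

/-! ### Vectors of the two qubit parties. -/

/-- The vector `(1, x)` of the plane, or its rotation `(-x, 1)`. -/
noncomputable def planarVec (x : ℝ) (e : Bool) : EuclideanSpace ℂ (Fin 2) :=
  if e then !₂[-(x : ℂ), 1] else !₂[1, (x : ℂ)]

theorem planarVec_ne_zero (x : ℝ) (e : Bool) : planarVec x e ≠ 0 := by
  intro h
  cases e
  · simpa [planarVec] using congrArg (fun v => v 0) h
  · simpa [planarVec] using congrArg (fun v => v 1) h

theorem inner_planarVec_of_ne (x : ℝ) {e e' : Bool} (h : e ≠ e') :
    inner ℂ (planarVec x e) (planarVec x e') = 0 := by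
  cases e <;> cases e' <;> simp_all [planarVec, PiLp.inner_apply, Fin.sum_univ_two]

/-- Distinct vectors of this kind are linearly independent: the determinants are, up to sign, x - x'
and 1 + x x'. Positivity keeps the latter nonzero, whence the `+ 1` in the labels below. -/
theorem eq_of_inner_planarVec {x x' : ℝ} {e e' : Bool} (hx : 0 < x) (hx' : 0 < x')
    {a : EuclideanSpace ℂ (Fin 2)} (ha : a ≠ 0) (h : inner ℂ (planarVec x e) a = 0)
    (h' : inner ℂ (planarVec x' e') a = 0) : x = x' ∧ e = e' := by
  have hpos : (1 + x * x' : ℂ) ≠ 0 := by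
    exact_mod_cast (by positivity : (0 : ℝ) < 1 + x * x').ne'
  have hzero : ¬ (a 0 = 0 ∧ a 1 = 0) := fun h0 => ha (by ext i; fin_cases i <;> simp [h0])
  cases e <;> cases e' <;>
    simp [planarVec, PiLp.inner_apply, Fin.sum_univ_two] at h h'
  · refine ⟨?_, rfl⟩
    by_contra hne
    have hne' : (x - x' : ℂ) ≠ 0 := by
      rw [sub_ne_zero]; exact_mod_cast hne
    have h1 : a 1 = 0 := by
      apply (mul_eq_zero.1 (?_ : (x - x' : ℂ) * a 1 = 0)).resolve_left hne'
      linear_combination h - h'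
    exact hzero ⟨by simpa [h1] using h, h1⟩
  · exfalso
    have h0 : a 0 = 0 := by
      apply (mul_eq_zero.1 (?_ : (1 + x * x' : ℂ) * a 0 = 0)).resolve_left hpos
      linear_combination h - x * h'
    exact hzero ⟨h0, by simpa [h0] using h'⟩
  · exfalso
    have h0 : a 0 = 0 := by
      apply (mul_eq_zero.1 (?_ : (1 + x * x' : ℂ) * a 0 = 0)).resolve_left hpos
      linear_combination h' - x' * h
    exact hzero ⟨h0, by simpa [h0] using h⟩
  · refine ⟨?_, rfl⟩
    by_contra hne
    have hne' : (x - x' : ℂ) ≠ 0 := by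
      rw [sub_ne_zero]; exact_mod_cast hne
    have h1 : a 0 = 0 := by
      apply (mul_eq_zero.1 (?_ : (x - x' : ℂ) * a 0 = 0)).resolve_left hne'
      linear_combination h' - h
    exact hzero ⟨h1, by simpa [h1] using h⟩

/-! ### Splitting the edges of the prism into 4-cycles and single edges. -/

section ParityClasses

variable {m : ℕ}

/-- The orthogonality class of a vertex of the prism in the first party: each pair of consecutive
cells `2i, 2i + 1` carries a 4-cycle. -/
def squareLabel (v : ZMod (2 * m) × Bool) : ℕ := v.1.val / 2 + 1

/-- The side of a vertex of the prism in its 4-cycle. -/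
def squareSide (v : ZMod (2 * m) × Bool) : Bool := (v.1.val.bodd) ^^ v.2

/-- The label of the edge joining `(2i + 1, s)` and `(2i + 2, s)`. -/
def edgeLabel (v : ZMod (2 * m) × Bool) : ℕ :=
  2 * (if v.1.val.bodd then v.1.val else (v.1 - 1).val) + v.2.toNat + 1

/-- The end of its edge at which a vertex lies. -/
def edgeSide (v : ZMod (2 * m) × Bool) : Bool := v.1.val.bodd

/-- The vertex opposite to a given one in its 4-cycle. -/
def opposite (v : ZMod (2 * m) × Bool) : ZMod (2 * m) × Bool :=
  (if v.1.val.bodd then v.1 - 1 else v.1 + 1, !v.2)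

theorem square_of_not (t : ZMod (2 * m)) (s : Bool) :
    squareLabel (t, s) = squareLabel (t, !s) ∧ squareSide (t, s) ≠ squareSide (t, !s) := by
  refine ⟨rfl, ?_⟩
  simp [squareSide]

variable [NeZero (2 * m)]

/-- Each side of a 4-cycle contains one vertex of each layer. -/
theorem eq_or_eq_opposite {v w : ZMod (2 * m) × Bool} (h : squareLabel v = squareLabel w)
    (h' : squareSide v = squareSide w) : w = v ∨ w = opposite v := by
  obtain ⟨t, s⟩ := v
  obtain ⟨t', s'⟩ := w
  simp only [squareLabel, squareSide, Nat.add_right_cancel_iff] at h h'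
  have h1 := Nat.bodd_add_div2 t.val
  have h2 := Nat.bodd_add_div2 t'.val
  rw [Nat.div2_val] at h1 h2
  have key : ∀ a b : ZMod (2 * m), a.val = b.val + 1 → a = b + 1 := fun a b hab => by
    rw [← ZMod.natCast_zmod_val a, hab]; simp
  by_cases hs : s = s'
  · subst hs
    have hb : t.val.bodd = t'.val.bodd := by simpa using h'
    left
    rw [hb] at h1
    exact Prod.ext (ZMod.val_injective _ (show t'.val = t.val by omega)) rfl
  · right
    have hs' : s' = !s := by cases s <;> cases s' <;> simp_all
    subst hs'
    refine Prod.ext ?_ rfl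
    cases hb : t.val.bodd <;> cases hb' : t'.val.bodd <;> simp [hb, hb'] at h' h1 h2
    · simp only [opposite, hb]
      exact key _ _ (by omega)
    · simp only [opposite, hb]
      exact eq_sub_of_add_eq (key _ _ (by omega)).symm

theorem eq_of_edgeLabel_eq {v w : ZMod (2 * m) × Bool} (h : edgeLabel v = edgeLabel w)
    (h' : edgeSide v = edgeSide w) : v = w := by
  obtain ⟨t, s⟩ := v
  obtain ⟨t', s'⟩ := w
  simp only [edgeSide] at h'
  simp only [edgeLabel, h', Nat.add_right_cancel_iff] at h
  have hs : s = s' := by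
    cases s <;> cases s' <;> simp only [Bool.toNat_true, Bool.toNat_false] at h ⊢ <;> omega
  subst hs
  refine Prod.ext ?_ rfl
  cases hb : t'.val.bodd <;> simp [hb] at h
  · have := ZMod.val_injective _ h
    simpa using this
  · exact ZMod.val_injective _ h

theorem square_or_edge_of_add_one (t : ZMod (2 * m)) (s : Bool) :
    (squareLabel (t, s) = squareLabel (t + 1, s) ∧ squareSide (t, s) ≠ squareSide (t + 1, s)) ∨
      (edgeLabel (t, s) = edgeLabel (t + 1, s) ∧ edgeSide (t, s) ≠ edgeSide (t + 1, s)) := by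
  have hm : m ≠ 0 := by have := NeZero.ne (2 * m); omega
  have : Fact (1 < 2 * m) := ⟨by omega⟩
  have hlt := ZMod.val_lt t
  have hval : (t + 1).val = (t.val + 1) % (2 * m) := by rw [ZMod.val_add, ZMod.val_one]
  -- The cycle has even length, so parity also alternates across the wrap-around.
  have hbodd : (t + 1).val.bodd = !t.val.bodd := by
    rcases Nat.lt_or_ge (t.val + 1) (2 * m) with h | h
    · rw [hval, Nat.mod_eq_of_lt h, Nat.bodd_succ]
    · have h2 : t.val + 1 = 2 * m := by omega
      have : (t.val + 1).bodd = false := by rw [h2]; simp [Nat.bodd_mul]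
      rw [hval, h2, Nat.mod_self, ← Nat.bodd_succ, Nat.succ_eq_add_one, this]
      rfl
  have h1 := Nat.bodd_add_div2 t.val
  rw [Nat.div2_val] at h1
  cases hb : t.val.bodd
  · left
    simp [hb] at h1
    have : (t + 1).val = t.val + 1 := by rw [hval, Nat.mod_eq_of_lt (by omega)]
    simp only [squareLabel, squareSide, hbodd, hb]
    refine ⟨by omega, by cases s <;> simp⟩
  · right
    simp [edgeLabel, edgeSide, hbodd, hb]

end ParityClasses

/-! ### Additive characters and Fourier inversion on `ZMod N`. -/

namespace ZMod

variable {N : ℕ} [NeZero N]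

local notation "χ" => (stdAddChar : AddChar (ZMod N) ℂ)

theorem conj_stdAddChar (j : ZMod N) : (starRingEnd ℂ) (χ j) = χ (-j) :=
  (AddChar.map_neg_eq_conj _ _).symm

theorem norm_stdAddChar (j : ZMod N) : ‖χ j‖ = 1 := by
  rw [stdAddChar_apply, Circle.norm_coe]

theorem re_sq_add_im_sq_stdAddChar (j : ZMod N) : (χ j).re ^ 2 + (χ j).im ^ 2 = 1 := by
  have := Complex.sq_norm (χ j)
  rw [norm_stdAddChar, Complex.normSq_apply] at this
  linarith

theorem re_stdAddChar (j : ZMod N) : (χ j).re = Real.cos (2 * Real.pi * j.val / N) := by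
  have h := stdAddChar_coe (N := N) (j.val : ℤ)
  rw [Int.cast_natCast, natCast_zmod_val] at h
  rw [h, show (2 * Real.pi * Complex.I * ((j.val : ℤ) : ℂ) / N : ℂ) =
    ((2 * Real.pi * j.val / N : ℝ) : ℂ) * Complex.I by push_cast; ring, Complex.exp_ofReal_mul_I_re]

/-- The angle of `χ j` lies strictly between θ and 2π - θ, with θ = 2π / N. -/
theorem re_stdAddChar_lt (hN : 4 ≤ N) {j : ZMod N} (h0 : j ≠ 0) (h1 : j ≠ 1) (h2 : j ≠ -1) :
    (χ j).re < (χ 1).re := by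
  have : Fact (1 < N) := ⟨by omega⟩
  have hpi := Real.pi_pos
  have hNpos : (0 : ℝ) < N := by positivity
  have hlt := val_lt j
  have e0 : j.val ≠ 0 := by simpa using h0
  have e1 : j.val ≠ 1 := fun h => h1 (by rw [← natCast_zmod_val j, h]; simp)
  have e2 : j.val ≠ N - 1 := fun h => h2 (by
    rw [← natCast_zmod_val j, h, Nat.cast_sub (by omega)]; simp)
  rw [re_stdAddChar, re_stdAddChar, val_one, Nat.cast_one, mul_one]
  have b1 : 2 * Real.pi / N < 2 * Real.pi * j.val / N := by
    have : (2 : ℝ) ≤ j.val := by exact_mod_cast (by omega : 2 ≤ j.val)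
    rw [div_lt_div_iff_of_pos_right hNpos]
    nlinarith
  have b2 : 2 * Real.pi / N < 2 * Real.pi - 2 * Real.pi * j.val / N := by
    have : (j.val : ℝ) + 2 ≤ N := by exact_mod_cast (by omega : j.val + 2 ≤ N)
    rw [lt_sub_iff_add_lt, ← add_div, div_lt_iff₀ hNpos]
    nlinarith
  rcases le_total (2 * Real.pi * j.val / N) Real.pi with h | h
  · exact Real.cos_lt_cos_of_nonneg_of_le_pi (by positivity) h b1
  · rw [← Real.cos_two_pi_sub]
    exact Real.cos_lt_cos_of_nonneg_of_le_pi (by positivity) (by linarith) b2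

theorem re_stdAddChar_one_nonneg (hN : 4 ≤ N) : 0 ≤ (χ 1).re := by
  have : Fact (1 < N) := ⟨by omega⟩
  have hpi := Real.pi_pos
  rw [re_stdAddChar, val_one, Nat.cast_one, mul_one]
  have : 2 * Real.pi / N ≤ Real.pi / 2 := by
    have : (4 : ℝ) ≤ N := by exact_mod_cast hN
    rw [div_le_div_iff₀ (by positivity) two_pos]
    nlinarith
  exact Real.cos_nonneg_of_neg_pi_div_two_le_of_le (by
    have : 0 ≤ 2 * Real.pi / N := by positivity
    linarith) this

theorem re_stdAddChar_one_lt (hN : 4 ≤ N) : (χ 1).re < 1 := by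
  have : Fact (1 < N) := ⟨by omega⟩
  have h0 : (χ 1).re ≤ 1 := (Complex.re_le_norm _).trans (norm_stdAddChar _).le
  refine lt_of_le_of_ne h0 fun h => ?_
  have him := re_sq_add_im_sq_stdAddChar (1 : ZMod N)
  rw [h] at him
  have : (χ 1).im = 0 := by nlinarith
  have h1 : χ 1 = χ 0 := by
    rw [AddChar.map_zero_eq_one]
    exact Complex.ext (by simpa using h) (by simpa using this)
  exact one_ne_zero (injective_stdAddChar h1)

theorem sum_stdAddChar_mul (b : ZMod N) :
    ∑ t, χ (t * b) = if b = 0 then (N : ℂ) else 0 := by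
  have := AddChar.sum_mulShift b (isPrimitive_stdAddChar N)
  rw [this, ZMod.card]
  split_ifs <;> simp

theorem sum_stdAddChar_mul_sum (h : ZMod N → ℂ) (f : ZMod N) :
    ∑ t, χ (f * t) * ∑ j, χ (-(j * t)) * h j = N * h f := by
  simp_rw [Finset.mul_sum]
  rw [Finset.sum_comm]
  have : ∀ j, ∑ t, χ (f * t) * (χ (-(j * t)) * h j) = (if f - j = 0 then (N : ℂ) else 0) * h j := by
    intro j
    rw [← sum_stdAddChar_mul, Finset.sum_mul]
    refine Finset.sum_congr rfl fun t _ => ?_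
    rw [← mul_assoc, ← AddChar.map_add_eq_mul]
    congr 2
    ring
  simp_rw [this]
  simp [sub_eq_zero]

end ZMod

/-! ### The symbol of the Gram matrix. -/

/-- The amplitude `(1 + cos θ) / 4`, with `θ = 2π / N`. -/
noncomputable def prismAmp (N : ℕ) [NeZero N] : ℝ := (1 + (ZMod.stdAddChar (1 : ZMod N)).re) / 4

/-- The coupling of the two layers. -/
noncomputable def prismCoupling (N : ℕ) [NeZero N] : ℝ := 2 - prismAmp N

/-- The symbol of the circulant block of the first layer. -/
noncomputable def prismWeight {N : ℕ} [NeZero N] (j : ZMod N) : ℝ :=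
  2 - prismAmp N * (ZMod.stdAddChar j).re - √(1 - prismAmp N ^ 2) * (ZMod.stdAddChar j).im

/-- The determinant of the symbol of the prism matrix. -/
noncomputable def prismDet {N : ℕ} [NeZero N] (j : ZMod N) : ℝ :=
  (1 - (ZMod.stdAddChar j).re) * ((ZMod.stdAddChar (1 : ZMod N)).re - (ZMod.stdAddChar j).re)

section Prism

variable {N : ℕ} [NeZero N]

local notation "χ" => (ZMod.stdAddChar : AddChar (ZMod N) ℂ)

theorem prismAmp_pos (hN : 4 ≤ N) : 0 < prismAmp N := by
  have := ZMod.re_stdAddChar_one_nonneg hN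
  unfold prismAmp
  linarith

theorem prismAmp_lt (hN : 4 ≤ N) : prismAmp N < 1 / 2 := by
  have := ZMod.re_stdAddChar_one_lt hN
  unfold prismAmp
  linarith

theorem sq_sqrt_prismAmp (hN : 4 ≤ N) : √(1 - prismAmp N ^ 2) ^ 2 = 1 - prismAmp N ^ 2 :=
  Real.sq_sqrt (by nlinarith [prismAmp_pos hN, prismAmp_lt hN])

theorem prismCoupling_pos (hN : 4 ≤ N) : 0 < prismCoupling N := by
  have := prismAmp_lt hN
  unfold prismCoupling
  linarith

/-- The terms subtracted from 2 form an inner product of two real unit vectors, hence are at most 1.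
-/
theorem prismWeight_pos (hN : 4 ≤ N) (j : ZMod N) : 0 < prismWeight j := by
  have h1 := sq_sqrt_prismAmp hN
  have h2 := ZMod.re_sq_add_im_sq_stdAddChar j
  unfold prismWeight
  nlinarith [sq_nonneg (prismAmp N - (χ j).re),
    sq_nonneg (√(1 - prismAmp N ^ 2) - (χ j).im)]

theorem re_stdAddChar_neg (j : ZMod N) : (χ (-j)).re = (χ j).re := by
  rw [← ZMod.conj_stdAddChar, Complex.conj_re]

theorem im_stdAddChar_neg (j : ZMod N) : (χ (-j)).im = -(χ j).im := by
  rw [← ZMod.conj_stdAddChar, Complex.conj_im]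

/-- With C the amplitude and c = Re `χ j`, the difference of the products is (1 - c)(4C - 1 - c).
The choice 4C - 1 = cos θ puts its zeros exactly at j = 0, 1, -1. -/
theorem prismWeight_mul_neg (hN : 4 ≤ N) (j : ZMod N) :
    prismWeight j * prismWeight (-j) = prismCoupling N ^ 2 + prismDet j := by
  have h1 := sq_sqrt_prismAmp hN
  have h2 := ZMod.re_sq_add_im_sq_stdAddChar j
  have h3 : (χ 1).re = 4 * prismAmp N - 1 := by unfold prismAmp; ring
  unfold prismWeight prismCoupling prismDet
  rw [re_stdAddChar_neg, im_stdAddChar_neg, h3]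
  linear_combination (-(χ j).im ^ 2) * h1 + (-1 + prismAmp N ^ 2) * h2

theorem prismDet_eq_zero {j : ZMod N} (h : j = 0 ∨ j = 1 ∨ j = -1) : prismDet j = 0 := by
  unfold prismDet
  rcases h with rfl | rfl | rfl
  · simp
  · simp
  · rw [re_stdAddChar_neg]; simp

theorem prismDet_pos (hN : 4 ≤ N) {j : ZMod N} (h0 : j ≠ 0) (h1 : j ≠ 1) (h2 : j ≠ -1) :
    0 < prismDet j := by
  have := ZMod.re_stdAddChar_lt hN h0 h1 h2
  have := ZMod.re_stdAddChar_one_lt hN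
  exact mul_pos (by linarith) (by linarith)

theorem prismWeight_zero : prismWeight (0 : ZMod N) = prismCoupling N := by
  simp [prismWeight, prismCoupling]

/-- This gives the two layers of `conicPoint` different radii. Equality, once squared, would force
C(1 - 2C)(2 - C) = 0, impossible for 0 < C < 1/2. -/
theorem prismWeight_one_ne (hN : 4 ≤ N) : prismWeight (1 : ZMod N) ≠ prismCoupling N := by
  have h1 := sq_sqrt_prismAmp hN
  have h2 := ZMod.re_sq_add_im_sq_stdAddChar (1 : ZMod N)
  have h3 : (χ 1).re = 4 * prismAmp N - 1 := by unfold prismAmp; ring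
  have h4 := prismAmp_pos hN
  have h5 := prismAmp_lt hN
  intro h
  unfold prismWeight prismCoupling at h
  rw [h3] at h h2
  set C := prismAmp N
  have h6 : √(1 - C ^ 2) * (χ 1).im = 2 * C * (1 - 2 * C) := by linear_combination -h
  have h7 : (1 - C ^ 2) * (χ 1).im ^ 2 = (2 * C * (1 - 2 * C)) ^ 2 := by
    rw [← h6, mul_pow, h1]
  have h8 : C * (1 - 2 * C) * (2 - C) = 0 := by nlinarith
  have : 0 < C * (1 - 2 * C) * (2 - C) :=
    mul_pos (mul_pos h4 (by linarith)) (by linarith)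
  linarith

end Prism

/-! ### Vectors of the third party. -/

section PrismVectors

variable {N : ℕ} [NeZero N]

local notation "χ" => (ZMod.stdAddChar : AddChar (ZMod N) ℂ)

/-- The coordinates of the vectors of the third party. -/
abbrev PrismCoord (N : ℕ) : Type := ZMod N ⊕ {j : ZMod N // j ≠ 0 ∧ j ≠ 1 ∧ j ≠ -1}

theorem card_prismCoord (hN : 4 ≤ N) : Fintype.card (PrismCoord N) = 2 * N - 3 := by
  have : Fact (2 < N) := ⟨by omega⟩
  have : Nontrivial (ZMod N) := by
    have : Fact (1 < N) := ⟨by omega⟩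
    infer_instance
  have h : Fintype.card {j : ZMod N // j ≠ 0 ∧ j ≠ 1 ∧ j ≠ -1} = N - 3 := by
    have hs : (Finset.univ.filter fun j : ZMod N => j ≠ 0 ∧ j ≠ 1 ∧ j ≠ -1) =
        ({0, 1, -1} : Finset (ZMod N))ᶜ := by
      ext j; simp
    have h3 : ({0, 1, -1} : Finset (ZMod N)).card = 3 :=
      Finset.card_eq_three.2 ⟨0, 1, -1, zero_ne_one, (neg_ne_zero.2 one_ne_zero).symm,
        ZMod.neg_one_ne_one.symm, rfl⟩
    rw [Fintype.card_subtype, hs, Finset.card_compl, ZMod.card, h3]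
  rw [Fintype.card_sum, ZMod.card, h]
  omega

/-- The amplitude of a layer in the first block of coordinates. -/
noncomputable def leadAmp (s : Bool) (j : ZMod N) : ℝ :=
  if s then prismCoupling N / √(prismWeight j) else √(prismWeight j)

/-- The amplitude of a layer in the second block of coordinates. -/
noncomputable def tailAmp (s : Bool) (j : ZMod N) : ℝ :=
  if s then √(prismDet j / prismWeight j) else 0

/-- The vectors of the third party. Two of them are orthogonal unless they belong to adjacent
vertices of the prism. -/
noncomputable def prismVec (v : ZMod N × Bool) : EuclideanSpace ℂ (PrismCoord N) :=
  WithLp.toLp 2 (Sum.elim (fun j => leadAmp v.2 j * χ (j * v.1))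
    (fun j => tailAmp v.2 j.1 * χ (j.1 * v.1)))

/-- The layer-`s` Fourier transform of `v ↦ ⟪prismVec v, y⟫`. -/
noncomputable def prismSymbol (s : Bool) (y : EuclideanSpace ℂ (PrismCoord N)) (j : ZMod N) : ℂ :=
  leadAmp s j * y (.inl j) +
    if h : j ≠ 0 ∧ j ≠ 1 ∧ j ≠ -1 then tailAmp s j * y (.inr ⟨j, h⟩) else 0

theorem inner_prismVec (t : ZMod N) (s : Bool) (y : EuclideanSpace ℂ (PrismCoord N)) :
    inner ℂ (prismVec (t, s)) y = ∑ j, χ (-(j * t)) * prismSymbol s y j := by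
  have hsub : ∑ j : {j : ZMod N // j ≠ 0 ∧ j ≠ 1 ∧ j ≠ -1},
      χ (-(j.1 * t)) * (tailAmp s j.1 * y (.inr j)) = ∑ j : ZMod N, χ (-(j * t)) *
        if h : j ≠ 0 ∧ j ≠ 1 ∧ j ≠ -1 then tailAmp s j * y (.inr ⟨j, h⟩) else 0 := by
    rw [← Finset.sum_subset (Finset.subset_univ
      (Finset.univ.filter fun j : ZMod N => j ≠ 0 ∧ j ≠ 1 ∧ j ≠ -1)),
      ← Finset.sum_subtype_eq_sum_filter, Finset.subtype_univ]
    · exact Finset.sum_congr rfl fun j _ => by rw [dif_pos j.2]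
    · intro j _ hj
      rw [dif_neg (by simpa using hj), mul_zero]
  simp only [prismSymbol, mul_add, Finset.sum_add_distrib]
  rw [← hsub, PiLp.inner_apply, Fintype.sum_sum_type]
  congr 1 <;>
  · refine Finset.sum_congr rfl fun j _ => ?_
    simp only [prismVec, Sum.elim_inl, Sum.elim_inr, RCLike.inner_apply, map_mul,
      Complex.conj_ofReal, ZMod.conj_stdAddChar]
    ring

theorem sum_stdAddChar_mul_inner (f : ZMod N) (s : Bool) (y : EuclideanSpace ℂ (PrismCoord N)) :
    ∑ t, χ (f * t) * inner ℂ (prismVec (t, s)) y = N * prismSymbol s y f := by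
  simp_rw [inner_prismVec]
  exact ZMod.sum_stdAddChar_mul_sum _ _

/-- At frequency j the two layers' amplitudes are the rows of a Cholesky factor of the 2 × 2 matrix
with diagonal `prismWeight j`, `prismWeight (-j)` and off-diagonal `prismCoupling N`. Its
determinant `prismDet j` vanishes at 0, 1, -1, so no tail coordinate is needed there. -/
theorem prismSymbol_prismVec (s s' : Bool) (t j : ZMod N) :
    prismSymbol s (prismVec (t, s')) j =
      ((leadAmp s j * leadAmp s' j +
        if j ≠ 0 ∧ j ≠ 1 ∧ j ≠ -1 then tailAmp s j * tailAmp s' j else 0 : ℝ) : ℂ) *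
          χ (j * t) := by
  simp only [prismSymbol, prismVec, Sum.elim_inl, Sum.elim_inr]
  split_ifs <;> push_cast <;> ring

theorem prismSymbol_ff (hN : 4 ≤ N) (t j : ZMod N) :
    prismSymbol false (prismVec (t, false)) j = prismWeight j * χ (j * t) := by
  rw [prismSymbol_prismVec]
  simp [leadAmp, tailAmp, Real.mul_self_sqrt (prismWeight_pos hN j).le]

theorem prismSymbol_ne (hN : 4 ≤ N) {s s' : Bool} (hs : s ≠ s') (t j : ZMod N) :
    prismSymbol s (prismVec (t, s')) j = prismCoupling N * χ (j * t) := by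
  rw [prismSymbol_prismVec]
  have h := (Real.sqrt_pos.2 (prismWeight_pos hN j)).ne'
  congr 2
  cases s <;> cases s' <;> simp [leadAmp, tailAmp] at hs ⊢ <;> field_simp

theorem prismDet_nonneg (hN : 4 ≤ N) (j : ZMod N) : 0 ≤ prismDet j := by
  by_cases h : j = 0 ∨ j = 1 ∨ j = -1
  · exact (prismDet_eq_zero h).ge
  · push Not at h
    exact (prismDet_pos hN h.1 h.2.1 h.2.2).le

theorem prismSymbol_tt (hN : 4 ≤ N) (t j : ZMod N) :
    prismSymbol true (prismVec (t, true)) j = prismWeight (-j) * χ (j * t) := by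
  rw [prismSymbol_prismVec]
  have hw := prismWeight_pos hN j
  have hdet : (if j ≠ 0 ∧ j ≠ 1 ∧ j ≠ -1 then tailAmp true j * tailAmp true j else 0) =
      prismDet j / prismWeight j := by
    split_ifs with h
    · simp only [tailAmp, if_true]
      exact Real.mul_self_sqrt (div_nonneg (prismDet_nonneg hN j) hw.le)
    · rw [prismDet_eq_zero (by tauto), zero_div]
  congr 2
  rw [hdet]
  simp only [leadAmp, if_true]
  rw [div_mul_div_comm, Real.mul_self_sqrt hw.le, ← add_div, div_eq_iff hw.ne', ← sq,
    ← prismWeight_mul_neg hN]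
  ring

/-- As a function of j the weight combines only the characters 1, `χ j` and `χ (-j)`, so within a
layer only cycle neighbours can interact. -/
theorem sum_prismWeight_mul {d : ZMod N} (h0 : d ≠ 0) (h1 : d ≠ 1) (h2 : d ≠ -1) :
    ∑ j, (prismWeight j : ℂ) * χ (j * d) = 0 := by
  have hw : ∀ j : ZMod N, (prismWeight j : ℂ) * χ (j * d) = 2 * χ (j * d)
      - (prismAmp N / 2 - √(1 - prismAmp N ^ 2) / 2 * Complex.I) * χ (j * (d + 1))
      - (prismAmp N / 2 + √(1 - prismAmp N ^ 2) / 2 * Complex.I) * χ (j * (d - 1)) := by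
    intro j
    have e1 : χ (j * (d + 1)) = χ (j * d) * χ j := by
      rw [← AddChar.map_add_eq_mul]; ring_nf
    have e2 : χ (j * (d - 1)) = χ (j * d) * χ (-j) := by
      rw [← AddChar.map_add_eq_mul]; ring_nf
    rw [e1, e2, ← ZMod.conj_stdAddChar]
    unfold prismWeight
    push_cast
    rw [Complex.re_eq_add_conj, Complex.im_eq_sub_conj]
    field_simp
    linear_combination (-(χ (j * d)) * √(1 - prismAmp N ^ 2) *
      (χ j - (starRingEnd ℂ) (χ j))) * Complex.I_sq
  simp_rw [hw]
  rw [Finset.sum_sub_distrib, Finset.sum_sub_distrib, ← Finset.mul_sum, ← Finset.mul_sum,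
    ← Finset.mul_sum, ZMod.sum_stdAddChar_mul, ZMod.sum_stdAddChar_mul, ZMod.sum_stdAddChar_mul,
    if_neg h0, if_neg (fun h => h2 (eq_neg_of_add_eq_zero_left h)), if_neg (sub_ne_zero.2 h1)]
  simp

theorem inner_prismVec_same (hN : 4 ≤ N) {t t' : ZMod N} (s : Bool) (h0 : t ≠ t')
    (h1 : t' ≠ t + 1) (h2 : t ≠ t' + 1) : inner ℂ (prismVec (t, s)) (prismVec (t', s)) = 0 := by
  rw [inner_prismVec]
  cases s
  · rw [← sum_prismWeight_mul (d := t' - t) (sub_ne_zero.2 h0.symm)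
      (fun h => h1 (by rw [← h]; ring))
      (fun h => h2 (by rw [← neg_eq_iff_eq_neg] at h; rw [← h]; ring))]
    refine Finset.sum_congr rfl fun j _ => ?_
    rw [prismSymbol_ff hN, mul_left_comm, ← AddChar.map_add_eq_mul]
    ring_nf
  · rw [← sum_prismWeight_mul (d := t - t') (sub_ne_zero.2 h0)
      (fun h => h2 (by rw [← h]; ring))
      (fun h => h1 (by rw [← neg_eq_iff_eq_neg] at h; rw [← h]; ring)),
      ← Equiv.sum_comp (Equiv.neg (ZMod N))]
    refine Finset.sum_congr rfl fun j _ => ?_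
    rw [prismSymbol_tt hN, mul_left_comm, ← AddChar.map_add_eq_mul]
    simp only [Equiv.neg_apply]
    ring_nf

/-- The coupling does not depend on j, so the off-diagonal block is a multiple of the identity. -/
theorem inner_prismVec_ne (hN : 4 ≤ N) {t t' : ZMod N} {s s' : Bool} (hs : s ≠ s') (h0 : t ≠ t') :
    inner ℂ (prismVec (t, s)) (prismVec (t', s')) = 0 := by
  rw [inner_prismVec]
  have : ∀ j, χ (-(j * t)) * prismSymbol s (prismVec (t', s')) j =
      prismCoupling N * χ (j * (t' - t)) := fun j => by
    rw [prismSymbol_ne hN hs, mul_left_comm, ← AddChar.map_add_eq_mul]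
    ring_nf
  simp_rw [this]
  rw [← Finset.mul_sum, ZMod.sum_stdAddChar_mul, if_neg (sub_ne_zero.2 h0.symm), mul_zero]

theorem prismVec_ne_zero (hN : 4 ≤ N) (v : ZMod N × Bool) : prismVec v ≠ 0 := by
  intro h
  have h0 : prismVec v (.inl 0) = 0 := by rw [h]; rfl
  have := (Real.sqrt_pos.2 (prismWeight_pos hN (0 : ZMod N))).ne'
  have hc := (prismCoupling_pos hN).ne'
  obtain ⟨t, s⟩ := v
  clear h
  cases s <;> simp_all [prismVec, leadAmp]

/-- The vectors of the third party span their space. -/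
theorem eq_zero_of_inner_prismVec (hN : 4 ≤ N) {y : EuclideanSpace ℂ (PrismCoord N)}
    (h : ∀ v, inner ℂ (prismVec v) y = 0) : y = 0 := by
  have hsym : ∀ s j, prismSymbol s y j = 0 := by
    intro s j
    have := sum_stdAddChar_mul_inner j s y
    simp only [h, mul_zero, Finset.sum_const_zero] at this
    exact (mul_eq_zero.1 this.symm).resolve_left (by exact_mod_cast NeZero.ne N)
  -- Layer `false` has no tail, so it determines the leading coordinates; layer `true` then gives
  -- the rest.
  have hl : ∀ j, y (.inl j) = 0 := by
    intro j
    have h1 := hsym false j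
    have h2 := (Real.sqrt_pos.2 (prismWeight_pos hN j)).ne'
    simpa [prismSymbol, leadAmp, tailAmp, h2] using h1
  ext i
  rcases i with j | ⟨j, hj⟩
  · exact hl j
  · have h1 := hsym true j
    have h2 := (Real.sqrt_pos.2 (div_pos (prismDet_pos hN hj.1 hj.2.1 hj.2.2)
      (prismWeight_pos hN j))).ne'
    rw [prismSymbol, hl, dif_pos hj, mul_zero, zero_add] at h1
    refine (mul_eq_zero.1 h1).resolve_left ?_
    simpa [tailAmp] using h2

/-! ### Linear dependencies of the third party's vectors. -/

/-- The points on a conic that describe the linear dependencies of the `prismVec`. -/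
noncomputable def conicPoint (v : ZMod N × Bool) : ℂ :=
  (if v.2 then ((prismWeight (1 : ZMod N) / prismCoupling N : ℝ) : ℂ) else 1) * χ v.1

theorem conicPoint_ne_zero (hN : 4 ≤ N) (v : ZMod N × Bool) : conicPoint v ≠ 0 := by
  have h1 := (prismWeight_pos hN (1 : ZMod N)).ne'
  have h2 := (prismCoupling_pos hN).ne'
  have h3 : χ v.1 ≠ 0 := by
    rw [← norm_ne_zero_iff, ZMod.norm_stdAddChar]; exact one_ne_zero
  refine mul_ne_zero ?_ h3
  split_ifs
  · exact_mod_cast div_ne_zero h1 h2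
  · exact one_ne_zero

theorem conicPoint_injective (hN : 4 ≤ N) :
    Function.Injective (conicPoint : ZMod N × Bool → ℂ) := by
  have h1 := prismWeight_pos hN (1 : ZMod N)
  have h2 := prismCoupling_pos hN
  have hr : prismWeight (1 : ZMod N) / prismCoupling N ≠ 1 := fun h =>
    prismWeight_one_ne hN ((div_eq_one_iff_eq h2.ne').1 h)
  have hnorm : ∀ v : ZMod N × Bool, ‖conicPoint v‖ =
      if v.2 then prismWeight (1 : ZMod N) / prismCoupling N else 1 := by
    intro v
    rw [conicPoint, norm_mul, ZMod.norm_stdAddChar, mul_one]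
    split_ifs
    · rw [Complex.norm_real, Real.norm_of_nonneg (div_pos h1 h2).le]
    · exact norm_one
  rintro ⟨t, s⟩ ⟨t', s'⟩ h
  have hs : s = s' := by
    have := congrArg norm h
    rw [hnorm, hnorm] at this
    cases s <;> cases s' <;> simp_all
  subst hs
  have hc : (if s then ((prismWeight (1 : ZMod N) / prismCoupling N : ℝ) : ℂ) else 1) ≠ 0 := by
    split_ifs
    · exact_mod_cast (div_pos h1 h2).ne'
    · exact one_ne_zero
  exact Prod.ext (ZMod.injective_stdAddChar (mul_left_cancel₀ hc h)) rfl

/-- At these frequencies the 2 × 2 symbol is singular; each gives one linear dependency. -/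
theorem prismSymbol_relation (hN : 4 ≤ N) {f : ZMod N} (hf : f = 0 ∨ f = 1 ∨ f = -1)
    (y : EuclideanSpace ℂ (PrismCoord N)) :
    prismCoupling N * prismSymbol false y f = prismWeight f * prismSymbol true y f := by
  have h : ¬ (f ≠ 0 ∧ f ≠ 1 ∧ f ≠ -1) := by tauto
  have hw := prismWeight_pos hN f
  have hs : ((√(prismWeight f) : ℝ) : ℂ) ≠ 0 := by exact_mod_cast (Real.sqrt_pos.2 hw).ne'
  have hsq : ((√(prismWeight f) : ℝ) : ℂ) ^ 2 = prismWeight f := by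
    exact_mod_cast Real.sq_sqrt hw.le
  simp only [prismSymbol, dif_neg h, add_zero, leadAmp, if_true, Bool.false_eq_true, if_false]
  rw [← hsq]
  push_cast
  field_simp

theorem sum_inner_relation (hN : 4 ≤ N) {f : ZMod N} (hf : f = 0 ∨ f = 1 ∨ f = -1)
    (y : EuclideanSpace ℂ (PrismCoord N)) :
    ∑ t, (prismCoupling N * (χ (f * t) * inner ℂ (prismVec (t, false)) y) -
      prismWeight f * (χ (f * t) * inner ℂ (prismVec (t, true)) y)) = 0 := by
  rw [Finset.sum_sub_distrib, ← Finset.mul_sum, ← Finset.mul_sum, sum_stdAddChar_mul_inner,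
    sum_stdAddChar_mul_inner]
  linear_combination (N : ℂ) * prismSymbol_relation hN hf y

/-- The linear dependencies of the `prismVec`: the points `conicPoint v` are annihilated on all
Laurent polynomials with exponents in `[-1, 1]`. -/
theorem sum_conicPoint_relation (hN : 4 ≤ N) (y : EuclideanSpace ℂ (PrismCoord N)) (p q r : ℂ) :
    ∑ v : ZMod N × Bool, (if v.2 then -1 else 1) *
      ((p + q * conicPoint v + r * (conicPoint v)⁻¹) * inner ℂ (prismVec v) y) = 0 := by
  have hg : (prismCoupling N : ℂ) ≠ 0 := by exact_mod_cast (prismCoupling_pos hN).ne'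
  have hw : (prismWeight (1 : ZMod N) : ℂ) ≠ 0 := by
    exact_mod_cast (prismWeight_pos hN (1 : ZMod N)).ne'
  -- Hence the layer ratios at frequencies 1 and -1 are mutually inverse, and all three dependencies
  -- are powers of one `conicPoint`.
  have hmul : (prismWeight (1 : ZMod N) : ℂ) * prismWeight (-1 : ZMod N) = prismCoupling N ^ 2 := by
    have := prismWeight_mul_neg hN (1 : ZMod N)
    rw [prismDet_eq_zero (by simp), add_zero] at this
    exact_mod_cast this
  have h0 := sum_inner_relation hN (f := 0) (by simp) y
  have h1 := sum_inner_relation hN (f := 1) (by simp) y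
  have h2 := sum_inner_relation hN (f := -1) (by simp) y
  have hinv : ∀ t, (χ t)⁻¹ = χ (-t) := fun t => (AddChar.map_neg_eq_inv _ _).symm
  have key : prismCoupling N * ∑ v : ZMod N × Bool, (if v.2 then -1 else 1) *
      ((p + q * conicPoint v + r * (conicPoint v)⁻¹) * inner ℂ (prismVec v) y) = 0 := by
    rw [← mul_zero p, ← h0]
    rw [← add_zero (p * _), ← mul_zero q, ← h1, ← add_zero (p * _ + _), ← mul_zero r, ← h2]
    rw [Finset.mul_sum, Finset.mul_sum, Finset.mul_sum, Finset.mul_sum,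
      Fintype.sum_prod_type, ← Finset.sum_add_distrib, ← Finset.sum_add_distrib]
    refine Finset.sum_congr rfl fun t _ => ?_
    have hneg : (prismWeight (-1 : ZMod N) : ℂ) = prismCoupling N ^ 2 / prismWeight (1 : ZMod N) := by
      rw [← hmul]; field_simp
    simp only [Fintype.sum_bool, conicPoint, if_true, Bool.false_eq_true, if_false, one_mul,
      mul_inv, hinv, zero_mul, AddChar.map_zero_eq_one, neg_mul, prismWeight_zero, hneg]
    push_cast
    field_simp
    ring
  exact (mul_eq_zero.1 key).resolve_left hg

theorem inner_prismVec_eq_zero_of_support (hN : 4 ≤ N) {y : EuclideanSpace ℂ (PrismCoord N)}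
    {w v₁ v₂ : ZMod N × Bool}
    (h : ∀ v, v ≠ w → v ≠ v₁ → v ≠ v₂ → inner ℂ (prismVec v) y = 0) :
    inner ℂ (prismVec w) y = 0 := by
  classical
  have hw := conicPoint_ne_zero hN w
  have avoid : ∀ u : ZMod N × Bool, ∃ ζ : ℂ, conicPoint w ≠ ζ ∧ (u ≠ w → conicPoint u = ζ) := by
    intro u
    by_cases hu : u = w
    -- If the excluded vertex is w itself, 0 is a harmless root, since conic points are nonzero.
    · exact ⟨0, hw, fun h => absurd hu h⟩
    · exact ⟨conicPoint u, fun h => hu (conicPoint_injective hN h).symm, fun _ => rfl⟩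
  obtain ⟨ζ₁, hζ₁, hu₁⟩ := avoid v₁
  obtain ⟨ζ₂, hζ₂, hu₂⟩ := avoid v₂
  -- The Laurent polynomial (ζ - ζ₁)(ζ - ζ₂) / ζ isolates the term of w.
  have hsum := sum_conicPoint_relation hN y (-(ζ₁ + ζ₂)) 1 (ζ₁ * ζ₂)
  have hfac : ∀ v : ZMod N × Bool, -(ζ₁ + ζ₂) + 1 * conicPoint v + ζ₁ * ζ₂ * (conicPoint v)⁻¹ =
      (conicPoint v)⁻¹ * ((conicPoint v - ζ₁) * (conicPoint v - ζ₂)) := by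
    intro v
    have := conicPoint_ne_zero hN v
    field_simp
    ring
  simp_rw [hfac] at hsum
  rw [Finset.sum_eq_single w] at hsum
  · have hs : (if w.2 then (-1 : ℂ) else 1) ≠ 0 := by split_ifs <;> simp
    have hf : (conicPoint w)⁻¹ * ((conicPoint w - ζ₁) * (conicPoint w - ζ₂)) ≠ 0 :=
      mul_ne_zero (inv_ne_zero hw) (mul_ne_zero (sub_ne_zero.2 hζ₁) (sub_ne_zero.2 hζ₂))
    exact (mul_eq_zero.1 ((mul_eq_zero.1 hsum).resolve_left hs)).resolve_left hf
  · intro v _ hv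
    by_cases h1 : v = v₁
    · subst h1; simp [hu₁ hv]
    by_cases h2 : v = v₂
    · subst h2; simp [hu₂ hv]
    rw [h v hv h1 h2, mul_zero, mul_zero]
  · simp

/-- Removing any three of the vectors of the third party leaves a spanning set. -/
theorem eq_zero_of_inner_prismVec_of_support (hN : 4 ≤ N) {y : EuclideanSpace ℂ (PrismCoord N)}
    (v₀ v₁ v₂ : ZMod N × Bool)
    (h : ∀ v, v ≠ v₀ → v ≠ v₁ → v ≠ v₂ → inner ℂ (prismVec v) y = 0) : y = 0 := by
  refine eq_zero_of_inner_prismVec hN fun w => ?_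
  by_cases h0 : w = v₀
  · subst h0
    exact inner_prismVec_eq_zero_of_support hN h
  by_cases h1 : w = v₁
  · subst h1
    exact inner_prismVec_eq_zero_of_support hN fun v hv hv0 hv2 => h v hv0 hv hv2
  by_cases h2 : w = v₂
  · subst h2
    exact inner_prismVec_eq_zero_of_support hN fun v hv hv0 hv1 => h v hv0 hv1 hv
  exact h w h0 h1 h2

end PrismVectors

/-! ### Assembling the basis and the theorem. -/

theorem mem_upbSizes_prism {m : ℕ} (hm : 2 ≤ m) : 4 * m ∈ upbSizes 2 2 (4 * m - 3) := by
  have hN : 4 ≤ 2 * m := by omega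
  have : NeZero (2 * m) := ⟨by omega⟩
  have hcard : Fintype.card (ZMod (2 * m) × Bool) = 4 * m := by
    rw [Fintype.card_prod, ZMod.card, Fintype.card_bool]; ring
  rw [← hcard]
  refine exists_isUPB_of_family (κ := PrismCoord (2 * m))
    (by rw [card_prismCoord hN, hcard]; omega)
    (fun v => planarVec (squareLabel v) (squareSide v))
    (fun v => planarVec (edgeLabel v) (edgeSide v)) prismVec
    (fun _ => planarVec_ne_zero _ _) (fun _ => planarVec_ne_zero _ _)
    (prismVec_ne_zero hN) ?_ ?_
  · have step : ∀ (t : ZMod (2 * m)) (s : Bool),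
        inner ℂ (planarVec (squareLabel (t, s)) (squareSide (t, s)))
          (planarVec (squareLabel (t + 1, s)) (squareSide (t + 1, s))) = 0 ∨
        inner ℂ (planarVec (edgeLabel (t, s)) (edgeSide (t, s)))
          (planarVec (edgeLabel (t + 1, s)) (edgeSide (t + 1, s))) = 0 := by
      intro t s
      rcases square_or_edge_of_add_one t s with ⟨h, h'⟩ | ⟨h, h'⟩
      · exact .inl (by rw [← h]; exact inner_planarVec_of_ne _ h')
      · exact .inr (by rw [← h]; exact inner_planarVec_of_ne _ h')
    rintro ⟨t, s⟩ ⟨t', s'⟩ hne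
    by_cases hs : s = s'
    · subst hs
      have ht : t ≠ t' := fun h => hne (h ▸ rfl)
      by_cases h1 : t' = t + 1
      · subst h1
        rcases step t s with h | h
        · exact .inl h
        · exact .inr (.inl h)
      by_cases h2 : t = t' + 1
      · subst h2
        rcases step t' s with h | h
        · exact .inl (inner_eq_zero_symm.1 h)
        · exact .inr (.inl (inner_eq_zero_symm.1 h))
      exact .inr (.inr (inner_prismVec_same hN s ht h1 h2))
    · by_cases ht : t = t'
      · subst ht
        have hs' : s' = !s := by cases s <;> cases s' <;> simp_all
        subst hs'
        obtain ⟨h, h'⟩ := square_of_not t s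
        exact .inl (by rw [← h]; exact inner_planarVec_of_ne _ h')
      · exact .inr (.inr (inner_prismVec_ne hN hs ht))
  · intro x y z hx hy hz
    by_contra! hcon
    obtain ⟨v₀, h₀⟩ : ∃ v₀ : ZMod (2 * m) × Bool, ∀ v,
        inner ℂ (planarVec (squareLabel v) (squareSide v)) x = 0 → v = v₀ ∨ v = opposite v₀ := by
      by_cases h : ∃ v₀ : ZMod (2 * m) × Bool,
          inner ℂ (planarVec (squareLabel v₀) (squareSide v₀)) x = 0
      · obtain ⟨v₀, h₀⟩ := h
        refine ⟨v₀, fun v hv => ?_⟩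
        obtain ⟨h1, h2⟩ := eq_of_inner_planarVec (by simp [squareLabel]; positivity)
          (by simp [squareLabel]; positivity) hx h₀ hv
        exact eq_or_eq_opposite (by exact_mod_cast h1) h2
      -- If x annihilates no vertex, any v₀ serves.
      · exact ⟨0, fun v hv => absurd ⟨v, hv⟩ h⟩
    obtain ⟨u, hu⟩ : ∃ u : ZMod (2 * m) × Bool, ∀ v,
        inner ℂ (planarVec (edgeLabel v) (edgeSide v)) y = 0 → v = u := by
      by_cases h : ∃ u : ZMod (2 * m) × Bool,
          inner ℂ (planarVec (edgeLabel u) (edgeSide u)) y = 0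
      · obtain ⟨u, hu⟩ := h
        refine ⟨u, fun v hv => ?_⟩
        obtain ⟨h1, h2⟩ := eq_of_inner_planarVec (by simp only [edgeLabel]; positivity)
          (by simp only [edgeLabel]; positivity) hy hv hu
        exact eq_of_edgeLabel_eq (by exact_mod_cast h1) h2
      · exact ⟨0, fun v hv => absurd ⟨v, hv⟩ h⟩
    refine hz (eq_zero_of_inner_prismVec_of_support hN v₀ (opposite v₀) u fun v hv0 hv1 hv2 => ?_)
    exact hcon v (fun h => (h₀ v h).elim hv0 hv1) (fun h => hv2 (hu v h))

theorem theorem2 (k : ℕ) (hk : 0 < k) :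
    IsMinUPBSize 2 2 (4 * k + 1) (fN 2 2 (4 * k + 1) + 1) ∧
      fN 2 2 (4 * k + 1) + 1 = 4 * k + 4 := by
  have hfN : fN 2 2 (4 * k + 1) + 1 = 4 * k + 4 := by
    unfold fN
    omega
  rw [hfN]
  refine ⟨⟨?_, ?_⟩, rfl⟩
  · have := mem_upbSizes_prism (m := k + 1) (by omega)
    rwa [show 4 * (k + 1) - 3 = 4 * k + 1 by omega] at this
  · rintro n ⟨S, hS, hn⟩
    exact hS.encard_ge ⟨2 * k, by ring⟩ hn
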